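/- Let $\Sigma$ be a closed connected oriented surface and let $\Gamma$ be a finite graph (loops and multiple edges allowed) cellularly embedded in $\Sigma$, such that every vertex has valence three or four and every face has at least two edges (a \emph{genon graph}). Let $n$, $E$, $F$ be the numbers of vertices, edges and faces. We call $\Gamma$ \emph{bicolourable} if its faces can be painted with two colours such that the faces on the two sides of each edge have different colours. A \emph{genon code} $C$ on $\Gamma$ is given by a label in $\{X,Y,Z\}$ at each corner of $\Gamma$, such that the three corners of a 3-valent vertex carry $X,Y,Z$ in some order and the four corners of a 4-valent vertex carry, in cyclic order, $a,b,a,b$ with $a\neq b$. Identifying single-qubit Pauli operators up to phase with $\mathbb{F}_2^2$ by $X=(1,0)$, $Z=(0,1)$, $Y=(1,1)$, and with one qubit at each vertex, $C\subset\mathbb{F}_2^n\oplus\mathbb{F}_2^n$ is the (isotropic) span of the face stabilizers, where the stabilizer of a face is the product of the labels at its corners. Let $C^\perp$ be the symplectic complement of $C$ (the space of logical operators), and let $[[n,k,d]]$ be the parameters of $C$: $\dim(C^\perp/C)=2k$, and $d$ is the minimum weight of an element of $C^\perp\setminus C$. Let $\mathbb{F}_2^{2E}$ have as basis the pairs (edge,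 side of that edge). Around an $m$-valent vertex there are $2m$ half-edge sides, two of them facing each corner. The space $S\subset\mathbb{F}_2^{2E}$ of \emph{string operators} consists of the vectors whose restriction to the half-edge sides around each vertex lies in the span of the following strands: at a 3-valent vertex, the sum of any two half-edge sides; at a 4-valent vertex, the sum of any two half-edge sides that face the same corner or opposite corners. The linear map $\phi\colon S\to C^\perp$ is defined locally at each vertex on these strands: a strand between two half-edge sides facing the same corner is sent to $0$; at a 3-valent vertex a strand between two different corners is sent to the label of the third corner; at a 4-valent vertex a strand between two opposite corners is sent to the common label of the other two corners. The \emph{internal string operator} of a face is the sum of all edge sides that face it. \textbf{Theorem.} If $C$ is a genon code with parameters $[[n,k,d]]$ on a genon graph $\Gamma$ with $F$ faces, then $$\dim(S)=\begin{cases}2k+2F-2&\text{if }\Gamma\text{ is bicolourable}\\2k+2F-1&\text{otherwise}\end{cases}\;=\;\begin{cases}2n+2&\text{if }\Gamma\text{ is bicolourable}\\2n+1&\text{otherwise,}\end{cases}$$ the map $\phi\colon S\to C^\perp$ is surjective, and its kernel is spanned by the internal string operators of the faces. -/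

import Mathlib

noncomputable section

/-! ## Quantum codes and symplectic geometry over the field with two elements -/

/-- The standard symplectic space `𝔽₂ⁿ ⊕ 𝔽₂ⁿ`, with the qubits labelled by a set `Q`;
the first component is the `X` part and the second is the `Z` part. -/
abbrev PauliSpace (Q : Type*) : Type _ := (Q → ZMod 2) × (Q → ZMod 2)

/-- The symplectic form `vᵀ Ω w = v_X · w_Z - v_Z · w_X`. -/
def sympForm {Q : Type*} [Fintype Q] (v w : PauliSpace Q) : ZMod 2 :=
  ∑ j, (v.1 j * w.2 j - v.2 j * w.1 j)

theorem sympForm_add_left {Q : Type*} [Fintype Q] (v v' w : PauliSpace Q) :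
    sympForm (v + v') w = sympForm v w + sympForm v' w := by
  simp only [sympForm, ← Finset.sum_add_distrib]
  exact Finset.sum_congr rfl fun j _ => by simp; ring

theorem sympForm_smul_left {Q : Type*} [Fintype Q] (a : ZMod 2) (v w : PauliSpace Q) :
    sympForm (a • v) w = a * sympForm v w := by
  simp only [sympForm, Finset.mul_sum]
  exact Finset.sum_congr rfl fun j _ => by simp; ring

theorem sympForm_comm {Q : Type*} [Fintype Q] (v w : PauliSpace Q) :
    sympForm v w = - sympForm w v := by
  simp only [sympForm, ← Finset.sum_neg_distrib]
  exact Finset.sum_congr rfl fun j _ => by ring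

/-- The symplectic complement `C^⊥ = {v | vᵀ Ω c = 0 for all c ∈ C}` of a subspace. -/
def sympPerp {Q : Type*} [Fintype Q] (C : Submodule (ZMod 2) (PauliSpace Q)) :
    Submodule (ZMod 2) (PauliSpace Q) where
  carrier := {v | ∀ c ∈ C, sympForm v c = 0}
  add_mem' := fun {a b} ha hb c hc => by rw [sympForm_add_left, ha c hc, hb c hc, add_zero]
  zero_mem' := fun c _ => by simp [sympForm]
  smul_mem' := fun a v hv c hc => by rw [sympForm_smul_left, hv c hc, mul_zero]

theorem mem_sympPerp_span {Q : Type*} [Fintype Q] {s : Set (PauliSpace Q)} {v : PauliSpace Q}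
    (h : ∀ c ∈ s, sympForm v c = 0) : v ∈ sympPerp (Submodule.span (ZMod 2) s) := by
  intro c hc
  induction hc using Submodule.span_induction with
  | mem x hx => exact h x hx
  | zero => simp [sympForm]
  | add x y _ _ hx hy =>
    rw [sympForm_comm, sympForm_add_left, neg_add, ← sympForm_comm, ← sympForm_comm, hx, hy,
      add_zero]
  | smul a x _ hx =>
    rw [sympForm_comm, sympForm_smul_left, ← mul_neg, ← sympForm_comm, hx, mul_zero]

/-- A quantum (stabilizer) code: an isotropic subspace. -/
structure QuantumCode (Q : Type*) [Fintype Q] where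
  /-- the codespace -/
  space : Submodule (ZMod 2) (PauliSpace Q)
  isotropic : space ≤ sympPerp space

/-- The logical space `C^⊥` of a quantum code. -/
def QuantumCode.logical {Q : Type*} [Fintype Q] (C : QuantumCode Q) :
    Submodule (ZMod 2) (PauliSpace Q) := sympPerp C.space

/-- The weight: the number of qubits on which `v` is not the identity. -/
def pauliWeight {Q : Type*} [Fintype Q] (v : PauliSpace Q) : ℕ :=
  Nat.card {j : Q // v.1 j ≠ 0 ∨ v.2 j ≠ 0}

/-- `C` has parameters `[[n, k, d]]`: `n` is the number of qubits, `k` the number of logical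
qubits (`C^⊥ / C` is a symplectic space of dimension `2 k`),
and `d` the minimum weight of an element of `C^⊥` outside `C` (`⊤` if there is none). -/
structure QuantumCode.HasParameters {Q : Type*} [Fintype Q] (C : QuantumCode Q)
    (n k : ℕ) (d : ℕ∞) : Prop where
  qubits : Nat.card Q = n
  logical_qubits :
    Module.finrank (ZMod 2) (C.logical ⧸ C.space.comap C.logical.subtype) = 2 * k
  distance : (⨅ v ∈ {v : PauliSpace Q | v ∈ C.logical ∧ v ∉ C.space}, (pauliWeight v : ℕ∞)) = d

/-- The non-identity single-qubit Pauli operators. -/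
inductive PauliLabel where
  | X
  | Y
  | Z

/-- A Pauli operator as a pair (`X` part, `Z` part). -/
def PauliLabel.vec : PauliLabel → ZMod 2 × ZMod 2
  | .X => (1, 0)
  | .Y => (1, 1)
  | .Z => (0, 1)

open Classical in
/-- The single-qubit Pauli operator `p` acting on the qubit `j`. -/
def pauliAt {Q : Type*} (j : Q) (p : ZMod 2 × ZMod 2) : PauliSpace Q :=
  (Pi.single j p.1, Pi.single j p.2)

/-! ## Genon graphs -/

/-- A genon graph: a finite graph (loops and multiple edges are allowed) with all valences three
or four, cellularly embedded in a closed connected oriented surface, without monogon faces.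
The embedding is recorded by its rotation system on the set `D` of darts (oriented edges):
`next d` is the dart following `d` counterclockwise around the tail of `d`, and `rev d` is
the same edge with the opposite orientation. The vertices are the cycles of `next`, the edges are
the cycles of `rev`, and the faces are the cycles of `next⁻¹ * rev`, which sends a dart to the
following dart along the boundary of the face on its left. -/
structure GenonGraph (D : Type*) [Fintype D] where
  /-- counterclockwise rotation of a dart about its tail -/
  next : Equiv.Perm D
  /-- reversal of the orientation of an edge -/
  rev : Equiv.Perm D
  nonempty : Nonempty D
  rev_rev : ∀ d, rev (rev d) = d
  rev_ne : ∀ d, rev d ≠ d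
  /-- the surface is connected -/
  connected : ∀ d d' : D, ∃ g ∈ Subgroup.closure {next, rev}, g d = d'
  /-- every vertex has valence three or four -/
  valence : ∀ d, Function.minimalPeriod next d = 3 ∨ Function.minimalPeriod next d = 4
  /-- every face has at least two edges -/
  no_monogon : ∀ d, (next⁻¹ * rev) d ≠ d

namespace GenonGraph

variable {D : Type*} [Fintype D] (Γ : GenonGraph D)

/-- The valence of the vertex at the tail of `d`. -/
def val (d : D) : ℕ := Function.minimalPeriod Γ.next d

/-- The dart following `d` along the boundary of the face on the left of `d`. -/
def faceNext : Equiv.Perm D := Γ.next⁻¹ * Γ.rev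

/-- The vertices of the graph. -/
def Vertex : Type _ := Quotient (Equiv.Perm.SameCycle.setoid Γ.next)

/-- The faces of the graph. -/
def Face : Type _ := Quotient (Equiv.Perm.SameCycle.setoid Γ.faceNext)

/-- The tail of a dart. -/
def vertexOf (d : D) : Γ.Vertex := Quotient.mk _ d

/-- The face on the left of a dart. The corner between `d` and `next d` also lies in it, and every
corner arises in this way from exactly one dart; so darts also label the corners. -/
def faceOf (d : D) : Γ.Face := Quotient.mk _ d

instance : Fintype Γ.Vertex := by
  classical exact @Fintype.ofFinite _ (Quotient.finite _)

instance : Fintype Γ.Face := by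
  classical exact @Fintype.ofFinite _ (Quotient.finite _)

/-- The faces can be painted with two colours such that the two faces on the two sides of any edge
have different colours. -/
def Bicolourable : Prop :=
  ∃ colour : Γ.Face → Bool, ∀ d, colour (Γ.faceOf d) ≠ colour (Γ.faceOf (Γ.rev d))

/-! ## String operators

The space `𝔽₂^{2E}` has a basis given by the pairs of an edge and one of its two sides; such a pair
is a dart (the edge of the dart, together with its left side), so the space is `D → ZMod 2`. -/

end GenonGraph

/-- A single strand through a vertex of valence `m`, joining two half-edge sides. Half-edges and
corners at the vertex are numbered counterclockwise, corner `i` lying between the half-edges `i` and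
`i + 1`. The index `(i, false)` stands for the side of half-edge `i`, and `(i, true)` for
the side of half-edge `i + 1`, that faces the corner `i`. -/
def strand {m : ℕ} (a b : Fin m × Bool) : Fin m × Bool → ZMod 2 :=
  Pi.single a 1 + Pi.single b 1

/-- The allowed strings around a 3-valent vertex: spanned by the strands between
any two half-edge sides. -/
def localStrings₃ : Submodule (ZMod 2) (Fin 3 × Bool → ZMod 2) :=
  Submodule.span (ZMod 2) {h | ∃ a b, h = strand a b}

/-- The allowed strings around a 4-valent vertex: spanned by the strands
between two half-edge sides that face the same corner or opposite corners. (Up to rotation and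
reflection: the strand turning inside a corner, the strand going around the outside of a
corner, and the strand going straight on while crossing to the other side.) -/
def localStrings₄ : Submodule (ZMod 2) (Fin 4 × Bool → ZMod 2) :=
  Submodule.span (ZMod 2) {h | ∃ a b, (b.1 = a.1 ∨ b.1 = a.1 + 2) ∧ h = strand a b}

theorem mem_localStrings₃ (h : Fin 3 × Bool → ZMod 2) :
    h ∈ localStrings₃ ↔
      h (0, false) + h (0, true) + (h (1, false) + h (1, true)) + (h (2, false) + h (2, true)) = 0 := by
  constructor
  · intro hh
    induction hh using Submodule.span_induction with
    | mem x hx =>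
      obtain ⟨a, b, rfl⟩ := hx
      revert a b; unfold strand; decide
    | zero => simp
    | add x y _ _ hx hy => simp only [Pi.add_apply]; linear_combination hx + hy
    | smul a x _ hx => simp only [Pi.smul_apply, smul_eq_mul]; linear_combination a * hx
  · intro hh
    have key : h = h (0, true) • strand (0, true) (0, false) + h (1, false) • strand (1, false) (0, false)
        + h (1, true) • strand (1, true) (0, false) + h (2, false) • strand (2, false) (0, false)
        + h (2, true) • strand (2, true) (0, false) := by
      funext ⟨i, b⟩
      fin_cases i <;> cases b <;> simp [strand]
      have h2 : ∀ x : ZMod 2, x + x = 0 := by decide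
      linear_combination hh - h2 (h (0, true) + h (1, false) + h (1, true) + h (2, false) + h (2, true))
    rw [key]
    refine add_mem (add_mem (add_mem (add_mem ?_ ?_) ?_) ?_) ?_ <;>
      exact Submodule.smul_mem _ _ (Submodule.subset_span ⟨_, _, rfl⟩)

theorem mem_localStrings₄ (h : Fin 4 × Bool → ZMod 2) :
    h ∈ localStrings₄ ↔
      h (0, false) + h (0, true) + (h (2, false) + h (2, true)) = 0 ∧
      h (1, false) + h (1, true) + (h (3, false) + h (3, true)) = 0 := by
  constructor
  · intro hh
    induction hh using Submodule.span_induction with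
    | mem x hx =>
      obtain ⟨a, b, hab, rfl⟩ := hx
      revert a b; unfold strand; decide
    | zero => simp
    | add x y _ _ hx hy =>
      simp only [Pi.add_apply]
      exact ⟨by linear_combination hx.1 + hy.1, by linear_combination hx.2 + hy.2⟩
    | smul a x _ hx =>
      simp only [Pi.smul_apply, smul_eq_mul]
      exact ⟨by linear_combination a * hx.1, by linear_combination a * hx.2⟩
  · rintro ⟨h0, h1⟩
    have key : h = h (0, true) • strand (0, true) (0, false) + h (2, false) • strand (2, false) (0, false)
        + h (2, true) • strand (2, true) (0, false) + h (1, true) • strand (1, true) (1, false)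
        + h (3, false) • strand (3, false) (1, false) + h (3, true) • strand (3, true) (1, false) := by
      have h2 : ∀ x : ZMod 2, x + x = 0 := by decide
      funext ⟨i, b⟩
      fin_cases i <;> cases b <;> simp [strand]
      · linear_combination h0 - h2 (h (0, true) + h (2, false) + h (2, true))
      · linear_combination h1 - h2 (h (1, true) + h (3, false) + h (3, true))
    rw [key]
    refine add_mem (add_mem (add_mem (add_mem (add_mem ?_ ?_) ?_) ?_) ?_) ?_ <;>
      exact Submodule.smul_mem _ _ (Submodule.subset_span ⟨_, _, by decide, rfl⟩)

namespace GenonGraph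

variable {D : Type*} [Fintype D] (Γ : GenonGraph D)

/-- The restriction of a vector of `𝔽₂^{2E}` to the `2m` half-edge sides around the tail of `d`,
a vertex of valence `m`, with the half-edges numbered counterclockwise starting from `d`. -/
def localString (m : ℕ) (d : D) : (D → ZMod 2) →ₗ[ZMod 2] (Fin m × Bool → ZMod 2) where
  toFun u a := if a.2 then u (Γ.rev ((Γ.next ^ ((a.1 : ℕ) + 1)) d)) else u ((Γ.next ^ (a.1 : ℕ)) d)
  map_add' u v := by funext a; by_cases h : a.2 = true <;> simp [h]
  map_smul' c u := by funext a; by_cases h : a.2 = true <;> simp [h]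

/-- The space `S` of string operators: the vectors of `𝔽₂^{2E}` that restrict to an allowed
string around every vertex. -/
def stringSpace : Submodule (ZMod 2) (D → ZMod 2) where
  carrier := {u | ∀ d, (Γ.val d = 3 → Γ.localString 3 d u ∈ localStrings₃) ∧
    (Γ.val d = 4 → Γ.localString 4 d u ∈ localStrings₄)}
  add_mem' := fun {u v} hu hv d => by
    rw [map_add, map_add]
    exact ⟨fun h => add_mem ((hu d).1 h) ((hv d).1 h), fun h => add_mem ((hu d).2 h) ((hv d).2 h)⟩
  zero_mem' := fun d => by
    rw [map_zero, map_zero]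
    exact ⟨fun _ => zero_mem _, fun _ => zero_mem _⟩
  smul_mem' := fun c u hu d => by
    rw [map_smul, map_smul]
    exact ⟨fun h => Submodule.smul_mem _ _ ((hu d).1 h), fun h => Submodule.smul_mem _ _ ((hu d).2 h)⟩

/-- The parity of the string operator `u` at the corner between `d` and `next d`: the number of
the two edge sides facing this corner that belong to `u`, modulo 2. -/
def cornerParity (u : D → ZMod 2) (d : D) : ZMod 2 := u d + u (Γ.rev (Γ.next d))

theorem next_three {d : D} (h : Γ.val d = 3) : Γ.next (Γ.next (Γ.next d)) = d := by
  have := Function.iterate_minimalPeriod (f := Γ.next) (x := d)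
  rw [show Function.minimalPeriod Γ.next d = 3 from h] at this
  exact this

theorem next_four {d : D} (h : Γ.val d = 4) :
    Γ.next (Γ.next (Γ.next (Γ.next d))) = d := by
  have := Function.iterate_minimalPeriod (f := Γ.next) (x := d)
  rw [show Function.minimalPeriod Γ.next d = 4 from h] at this
  exact this

theorem val_cases (d : D) : Γ.val d = 3 ∨ Γ.val d = 4 := Γ.valence d

theorem faceOf_eq_of_corner (d : D) : Γ.faceOf (Γ.rev (Γ.next d)) = Γ.faceOf d := by
  refine Quotient.sound ⟨1, ?_⟩
  simp [faceNext, Γ.rev_rev]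

open Classical in
theorem sum_at_vertex {M : Type*} [AddCommMonoid M] (g : D → M) (e : D) :
    (∑ d : D, if Γ.vertexOf d = Γ.vertexOf e then g d else 0) =
      ∑ i ∈ Finset.range (Γ.val e), g (Γ.next^[i] e) := by
  rw [← Finset.sum_filter]
  symm
  refine Finset.sum_bij (fun i _ => Γ.next^[i] e) ?_ ?_ ?_ (fun _ _ => rfl)
  · intro i _
    refine Finset.mem_filter.2 ⟨Finset.mem_univ _, ?_⟩
    refine (Quotient.sound ⟨i, ?_⟩ : Γ.vertexOf e = Γ.vertexOf (Γ.next^[i] e)).symm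
    simp [Equiv.Perm.iterate_eq_pow]
  · intro i hi j hj h
    exact Function.iterate_injOn_Iio_minimalPeriod (by simpa [val] using hi) (by simpa [val] using hj) h
  · intro d hd
    obtain ⟨n, -, hn⟩ :=
      Equiv.Perm.SameCycle.exists_pow_eq' (Quotient.exact (Finset.mem_filter.1 hd).2.symm)
    have hpos : 0 < Γ.val e := by rcases Γ.valence e with h | h <;> simp [val, h]
    refine ⟨n % Γ.val e, Finset.mem_range.2 (Nat.mod_lt _ hpos), ?_⟩
    rw [val, Function.iterate_mod_minimalPeriod_eq, Equiv.Perm.iterate_eq_pow, hn]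

theorem mem_stringSpace (u : D → ZMod 2) : u ∈ Γ.stringSpace ↔ ∀ d,
    (Γ.val d = 3 → Γ.cornerParity u d + Γ.cornerParity u (Γ.next d)
      + Γ.cornerParity u (Γ.next (Γ.next d)) = 0) ∧
    (Γ.val d = 4 →
      Γ.cornerParity u d + Γ.cornerParity u (Γ.next (Γ.next d)) = 0 ∧
      Γ.cornerParity u (Γ.next d) + Γ.cornerParity u (Γ.next (Γ.next (Γ.next d))) = 0) := by
  refine forall_congr' fun d => ?_
  rw [mem_localStrings₃, mem_localStrings₄]
  simp [localString, cornerParity, pow_succ, Equiv.Perm.mul_apply]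

open Classical in
/-- The string operator internal to the face `f`, as a vector: all edge sides facing `f`. -/
def internalVec (f : Γ.Face) : D → ZMod 2 := fun d => if Γ.faceOf d = f then 1 else 0

theorem internalVec_cornerParity (f : Γ.Face) (d : D) :
    Γ.cornerParity (Γ.internalVec f) d = 0 := by
  unfold cornerParity internalVec
  rw [Γ.faceOf_eq_of_corner d]
  exact (by decide : ∀ x : ZMod 2, x + x = 0) _

/-- The string operator internal to the face `f`. -/
def internalString (f : Γ.Face) : Γ.stringSpace :=
  ⟨Γ.internalVec f, (Γ.mem_stringSpace _).2 fun d => by simp [internalVec_cornerParity]⟩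

/-- The string operator external to the face `f`, as a vector: the other sides of
the edges of `f`. -/
def externalVec (f : Γ.Face) : D → ZMod 2 := fun d => Γ.internalVec f (Γ.rev d)

theorem externalVec_cornerParity (f : Γ.Face) (d : D) :
    Γ.cornerParity (Γ.externalVec f) d =
      Γ.internalVec f (Γ.next⁻¹ d) + Γ.internalVec f (Γ.next d) := by
  have : Γ.faceOf (Γ.rev d) = Γ.faceOf (Γ.next⁻¹ d) := by
    have := Γ.faceOf_eq_of_corner (Γ.next⁻¹ d)
    simpa using this
  unfold cornerParity externalVec internalVec
  rw [this, Γ.rev_rev]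

/-- The string operator external to the face `f`. -/
def externalString (f : Γ.Face) : Γ.stringSpace :=
  ⟨Γ.externalVec f, (Γ.mem_stringSpace _).2 fun d => by
    have h2 : ∀ x : ZMod 2, x + x = 0 := by decide
    have hinv : ∀ e, Γ.next⁻¹ (Γ.next e) = e := Γ.next.symm_apply_apply
    simp only [externalVec_cornerParity, hinv]
    refine ⟨fun h => ?_, fun h => ?_⟩
    · have e : Γ.next⁻¹ d = Γ.next (Γ.next d) := by
        rw [Equiv.Perm.inv_eq_iff_eq, Γ.next_three h]
      rw [e, Γ.next_three h]
      linear_combination h2 (Γ.internalVec f (Γ.next (Γ.next d)) + Γ.internalVec f (Γ.next d)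
        + Γ.internalVec f d)
    · have e : Γ.next⁻¹ d = Γ.next (Γ.next (Γ.next d)) := by
        rw [Equiv.Perm.inv_eq_iff_eq, Γ.next_four h]
      rw [e, Γ.next_four h]
      exact ⟨by linear_combination h2 (Γ.internalVec f (Γ.next (Γ.next (Γ.next d)))
        + Γ.internalVec f (Γ.next d)), by linear_combination h2 (Γ.internalVec f d
        + Γ.internalVec f (Γ.next (Γ.next d)))⟩⟩

end GenonGraph

/-! ## Genon codes -/

/-- A genon code on `Γ`: Pauli operators are placed at the corners of the graph, such that the three
corners of a 3-valent vertex carry `X`, `Y`, `Z` in some order, and the four corners of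
a 4-valent vertex carry, in cyclic order, `a`, `b`, `a`, `b` for two different Paulis `a`, `b`. -/
structure GenonCode {D : Type*} [Fintype D] (Γ : GenonGraph D) where
  /-- the Pauli operator at the corner between `d` and `next d`, which belongs to the face on the
  left of `d` -/
  label : D → PauliLabel
  label₃ : ∀ d, Γ.val d = 3 → label d ≠ label (Γ.next d) ∧
    label (Γ.next d) ≠ label (Γ.next (Γ.next d)) ∧ label d ≠ label (Γ.next (Γ.next d))
  label₄ : ∀ d, Γ.val d = 4 →
    label d ≠ label (Γ.next d) ∧ label (Γ.next (Γ.next d)) = label d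

namespace GenonCode

variable {D : Type*} [Fintype D] {Γ : GenonGraph D} (C : GenonCode Γ)

open Classical in
/-- The stabilizer of the face `f`: the product over all corners of `f` of the Pauli operator at that
corner, acting on the qubit at the vertex of that corner. -/
def stabilizer (f : Γ.Face) : PauliSpace Γ.Vertex :=
  ∑ d : D, if Γ.faceOf d = f then pauliAt (Γ.vertexOf d) (C.label d).vec else 0

/-- The subspace spanned by the face stabilizers. -/
def codespace : Submodule (ZMod 2) (PauliSpace Γ.Vertex) :=
  Submodule.span (ZMod 2) (Set.range C.stabilizer)

/-- The Pauli operator that the string operator `u` gives at the tail of `d`. If `a`, `b` are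
the labels of the corner of `d` and of the next corner, and `x`, `y` the parities
of `u` at these two corners, this is `y • a + x • b`. On an allowed string it does
not depend on the choice of the dart `d` at the vertex (`localPauli_next`).
It sends a strand that turns inside a corner to `0`. At a 4-valent vertex it sends a strand between
the two corners opposite to each other to the label of the other two corners; at a 3-valent vertex
it sends a strand between two different corners to the label of the third corner. -/
def localPauli (u : D → ZMod 2) (d : D) : ZMod 2 × ZMod 2 :=
  Γ.cornerParity u (Γ.next d) • (C.label d).vec + Γ.cornerParity u d • (C.label (Γ.next d)).vec

theorem localPauli_next {u : D → ZMod 2} (hu : u ∈ Γ.stringSpace) (d : D) :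
    C.localPauli u (Γ.next d) = C.localPauli u d := by
  have h := (Γ.mem_stringSpace u).1 hu d
  unfold localPauli
  rcases Γ.val_cases d with hd | hd
  · obtain ⟨h1, h2, h3⟩ := C.label₃ d hd
    have h := h.1 hd
    revert h h1 h2 h3
    generalize Γ.cornerParity u d = x
    generalize Γ.cornerParity u (Γ.next d) = y
    generalize Γ.cornerParity u (Γ.next (Γ.next d)) = z
    generalize C.label d = a
    generalize C.label (Γ.next d) = b
    generalize C.label (Γ.next (Γ.next d)) = c
    cases a <;> cases b <;> cases c <;> simp <;> revert x y z <;> decide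
  · obtain ⟨h1, h2⟩ := C.label₄ d hd
    have h := (h.2 hd).1
    rw [h2, show Γ.cornerParity u (Γ.next (Γ.next d)) = Γ.cornerParity u d from by
      revert h
      generalize Γ.cornerParity u d = x
      generalize Γ.cornerParity u (Γ.next (Γ.next d)) = y
      revert x y; decide, add_comm]

theorem localPauli_eq {u : D → ZMod 2} (hu : u ∈ Γ.stringSpace) {d d' : D}
    (h : Γ.vertexOf d = Γ.vertexOf d') : C.localPauli u d = C.localPauli u d' := by
  obtain ⟨n, -, hn⟩ := Equiv.Perm.SameCycle.exists_pow_eq' (Quotient.exact h)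
  rw [← hn]
  clear hn h
  induction n with
  | zero => rfl
  | succ n ih => rw [pow_succ', Equiv.Perm.mul_apply, localPauli_next C hu, ih]

/-- The map `φ` from string operators to Pauli operators. -/
def toPauli : Γ.stringSpace →ₗ[ZMod 2] PauliSpace Γ.Vertex where
  toFun u := (fun v => (C.localPauli u.1 (Quotient.out v)).1,
    fun v => (C.localPauli u.1 (Quotient.out v)).2)
  map_add' u v := by
    ext w <;> simp [localPauli, GenonGraph.cornerParity] <;> ring
  map_smul' c u := by
    ext w <;> simp [localPauli, GenonGraph.cornerParity] <;> ring

theorem toPauli_apply (u : Γ.stringSpace) (d : D) :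
    ((C.toPauli u).1 (Γ.vertexOf d), (C.toPauli u).2 (Γ.vertexOf d)) = C.localPauli u.1 d :=
  C.localPauli_eq u.2 (Quotient.out_eq (Γ.vertexOf d))

theorem toPauli_mem (u : Γ.stringSpace) : C.toPauli u ∈ sympPerp C.codespace := by
  classical
  refine mem_sympPerp_span ?_
  rintro _ ⟨f, rfl⟩
  have hsum : sympForm (C.toPauli u) (C.stabilizer f) =
      ∑ d : D, if Γ.faceOf d = f then
        sympForm (C.toPauli u) (pauliAt (Γ.vertexOf d) (C.label d).vec) else 0 := by
    unfold stabilizer sympForm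
    simp only [Prod.fst_sum, Prod.snd_sum, Finset.sum_apply, Finset.mul_sum,
      ← Finset.sum_sub_distrib]
    rw [Finset.sum_comm]
    refine Finset.sum_congr rfl fun d _ => ?_
    split_ifs <;> simp
  have hloc : ∀ d, sympForm (C.toPauli u) (pauliAt (Γ.vertexOf d) (C.label d).vec) =
      Γ.cornerParity u.1 d := by
    intro d
    have h1 : sympForm (C.toPauli u) (pauliAt (Γ.vertexOf d) (C.label d).vec) =
        (C.localPauli u.1 d).1 * (C.label d).vec.2 - (C.localPauli u.1 d).2 * (C.label d).vec.1 := by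
      rw [← C.toPauli_apply u d]
      simp [sympForm, pauliAt, Pi.single_apply, Finset.sum_sub_distrib]
    rw [h1]
    have hne : C.label d ≠ C.label (Γ.next d) := by
      rcases Γ.val_cases d with hd | hd
      · exact (C.label₃ d hd).1
      · exact (C.label₄ d hd).1
    unfold localPauli
    revert hne
    generalize Γ.cornerParity u.1 d = x
    generalize Γ.cornerParity u.1 (Γ.next d) = y
    generalize C.label d = a
    generalize C.label (Γ.next d) = b
    cases a <;> cases b <;> simp <;> revert x y <;> decide
  rw [hsum]
  simp only [hloc, GenonGraph.cornerParity]
  have hperm : ∑ d : D, (if Γ.faceOf d = f then u.1 (Γ.rev (Γ.next d)) else 0) =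
      ∑ d : D, (if Γ.faceOf d = f then u.1 d else 0) := by
    rw [← Equiv.sum_comp (Γ.rev * Γ.next) (fun d => if Γ.faceOf d = f then u.1 d else 0)]
    refine Finset.sum_congr rfl fun d _ => ?_
    rw [Equiv.Perm.mul_apply, Γ.faceOf_eq_of_corner d]
  have hsplit : ∀ d, (if Γ.faceOf d = f then u.1 d + u.1 (Γ.rev (Γ.next d)) else 0) =
      (if Γ.faceOf d = f then u.1 d else 0) +
        (if Γ.faceOf d = f then u.1 (Γ.rev (Γ.next d)) else 0) := by
    intro d; split_ifs <;> simp
  simp only [hsplit]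
  rw [Finset.sum_add_distrib, hperm]
  exact (by decide : ∀ x : ZMod 2, x + x = 0) _

/-- The string operator external to a face gives the stabilizer of that face. -/
theorem toPauli_externalString (f : Γ.Face) :
    C.toPauli (Γ.externalString f) = C.stabilizer f := by
  classical
  have key : ∀ v : Γ.Vertex,
      ((C.toPauli (Γ.externalString f)).1 v, (C.toPauli (Γ.externalString f)).2 v) =
        ((C.stabilizer f).1 v, (C.stabilizer f).2 v) := by
    intro v
    obtain ⟨e, rfl⟩ : ∃ e, Γ.vertexOf e = v := ⟨Quotient.out v, Quotient.out_eq v⟩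
    have hst : ((C.stabilizer f).1 (Γ.vertexOf e), (C.stabilizer f).2 (Γ.vertexOf e)) =
        ∑ d : D, if Γ.vertexOf d = Γ.vertexOf e then Γ.internalVec f d • (C.label d).vec else 0 := by
      ext
      all_goals
        simp only [stabilizer, Prod.fst_sum, Prod.snd_sum, Finset.sum_apply]
        refine Finset.sum_congr rfl fun d _ => ?_
        by_cases h1 : Γ.faceOf d = f <;> by_cases h2 : Γ.vertexOf d = Γ.vertexOf e <;>
          simp [h1, h2, pauliAt, GenonGraph.internalVec]
    have hinv : ∀ e, Γ.next⁻¹ (Γ.next e) = e := Γ.next.symm_apply_apply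
    rw [C.toPauli_apply, hst, Γ.sum_at_vertex]
    change C.localPauli (Γ.externalVec f) e = _
    unfold localPauli
    simp only [GenonGraph.externalVec_cornerParity, hinv]
    rcases Γ.val_cases e with h | h
    · have e1 : Γ.next⁻¹ e = Γ.next (Γ.next e) := by
        rw [Equiv.Perm.inv_eq_iff_eq, Γ.next_three h]
      obtain ⟨h1, h2, h3⟩ := C.label₃ e h
      rw [h, e1]
      simp only [Finset.sum_range_succ, Finset.sum_range_zero, zero_add, Function.iterate_succ,
        Function.iterate_zero, Function.comp_apply, id]
      revert h1 h2 h3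
      generalize Γ.internalVec f e = x
      generalize Γ.internalVec f (Γ.next e) = y
      generalize Γ.internalVec f (Γ.next (Γ.next e)) = z
      generalize C.label e = a
      generalize C.label (Γ.next e) = b
      generalize C.label (Γ.next (Γ.next e)) = c
      cases a <;> cases b <;> cases c <;> simp <;> revert x y z <;> decide
    · have e1 : Γ.next⁻¹ e = Γ.next (Γ.next (Γ.next e)) := by
        rw [Equiv.Perm.inv_eq_iff_eq, Γ.next_four h]
      have hv : Γ.val (Γ.next e) = 4 := by
        rw [← h]
        exact Function.minimalPeriod_apply (Γ.next.injective.mem_periodicPts e)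
      have h2 := (C.label₄ e h).2
      have h3 := (C.label₄ _ hv).2
      rw [h, e1]
      simp only [Finset.sum_range_succ, Finset.sum_range_zero, zero_add, Function.iterate_succ,
        Function.iterate_zero, Function.comp_apply, id]
      rw [h2, h3]
      module
  exact Prod.ext (funext fun v => congrArg Prod.fst (key v))
    (funext fun v => congrArg Prod.snd (key v))

theorem codespace_isotropic : C.codespace ≤ sympPerp C.codespace := by
  refine Submodule.span_le.2 ?_
  rintro _ ⟨f, rfl⟩
  rw [← C.toPauli_externalString f]
  exact C.toPauli_mem _

/-- The quantum code, with one qubit for each vertex. -/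
def code : QuantumCode Γ.Vertex := ⟨C.codespace, C.codespace_isotropic⟩

/-- The linear map `φ : S → C^⊥` from string operators to logical operators. -/
def phi : Γ.stringSpace →ₗ[ZMod 2] C.code.logical :=
  C.toPauli.codRestrict C.code.logical C.toPauli_mem

end GenonCode

end

/-!
The parity of a string operator at a corner can be read off from its image under `φ`: it is the
symplectic product of that Pauli operator with the label of the corner (`cornerParity_eq`). Hence
a string operator is in the kernel of `φ` exactly if all its corner parities vanish, i.e. if it is constant along every face (`ker_phi`).

For surjectivity, a Pauli operator `v` prescribes the corner parities
`x d = ⟨v, label d⟩`, and a vector `u` with these corner parities solves the difference equation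
`u d + u (rev (next d)) = x d` along each face boundary. It is solvable if and only if `x` sums to
zero over each face (`exists_sub_comp_perm_eq`), which says that `v` commutes with
the face stabilizers (`phi_surjective`).

So `dim S = dim C^⊥ + F = 2 n - dim C + F`, and `dim C^⊥ = 2 k + dim C`. It remains to count the
relations between the `F` face stabilizers. As `stabilizer f` is the image of the external string
operator of `f`, a sum of face stabilizers with coefficients `c` vanishes exactly if faces that are
two corners apart around a vertex have equal coefficients
(`linearCombination_stabilizer_eq_zero_iff`). Equivalently the jump of `c` across an edge
is the same for all edges at a vertex, hence for all edges, by connectedness. Jump `0` means that `c` is constant, and jump `1` that `c` is a proper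
two-colouring of the faces. So the relations have dimension `2` if `Γ` is bicolourable, and `1`
otherwise.
-/

/-! ### Difference equations along the cycles of a permutation -/

/-- On a finite set, a function whose sum over each cycle of `σ` vanishes is a coboundary for `σ`.
The map `q` names the cycles. A linear functional that vanishes on the coboundaries has
`σ`-invariant coefficients, so it factors through the sums over the cycles. -/
theorem exists_sub_comp_perm_eq {K D ι : Type*} [Field K] [Fintype D] [Fintype ι] [DecidableEq ι]
    (σ : Equiv.Perm D) (q : D → ι)
    (hq : ∀ d d', q d = q d' → σ.SameCycle d d') (x : D → K)
    (hx : ∀ i, ∑ d, (if q d = i then x d else 0) = 0) :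
    ∃ u : D → K, ∀ d, u (σ d) - u d = x d := by
  classical
  let T : (D → K) →ₗ[K] (D → K) := LinearMap.funLeft K K σ - LinearMap.id
  by_contra! hne
  have hxT : x ∉ LinearMap.range T := by
    rintro ⟨u, rfl⟩
    obtain ⟨d, hd⟩ := hne u
    exact hd rfl
  obtain ⟨f, hfx, hf⟩ := Submodule.exists_le_ker_of_notMem hxT
  apply hfx
  have hinv : ∀ d, f (Pi.single (σ d) 1) = f (Pi.single d 1) := by
    intro d
    have h : f (T (Pi.single (σ d) 1)) = 0 := hf ⟨_, rfl⟩
    have h1 : T (Pi.single (σ d) 1) = Pi.single d 1 - Pi.single (σ d) 1 := by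
      ext e
      simp [T, LinearMap.funLeft_apply, Pi.single_apply]
    rw [h1, map_sub, sub_eq_zero] at h
    exact h.symm
  have hcyc : ∀ d d', q d = q d' → f (Pi.single d 1) = f (Pi.single d' 1) := by
    intro d d' h
    obtain ⟨n, -, rfl⟩ := (hq d d' h).exists_pow_eq'
    clear h
    induction n with
    | zero => rfl
    | succ n ih => rw [pow_succ', Equiv.Perm.mul_apply, hinv, ih]
  have hexp : f x = ∑ d, x d * f (Pi.single d 1) := by
    conv_lhs => rw [pi_eq_sum_univ' x]
    simp [map_sum]
  have hfib : f x = ∑ i, ∑ d, if q d = i then x d * f (Pi.single d 1) else 0 := by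
    rw [hexp, Finset.sum_comm]
    simp
  rw [hfib]
  refine Finset.sum_eq_zero fun i _ => ?_
  by_cases hi : ∃ d, q d = i
  · obtain ⟨e, rfl⟩ := hi
    have h : ∑ d, (if q d = q e then x d else 0) * f (Pi.single e 1) = 0 := by
      rw [← Finset.sum_mul, hx, zero_mul]
    refine (Finset.sum_congr rfl fun d _ => ?_).trans h
    split_ifs with hd
    · rw [hcyc d e hd]
    · rw [zero_mul]
  · exact Finset.sum_eq_zero fun d _ => if_neg fun h => hi ⟨d, h⟩

/-! ### Symplectic complements -/

/-- The symplectic form as a bilinear form. -/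
def sympBilin (Q : Type*) [Fintype Q] : LinearMap.BilinForm (ZMod 2) (PauliSpace Q) :=
  LinearMap.mk₂ (ZMod 2) sympForm sympForm_add_left sympForm_smul_left
    (fun v w w' => by
      rw [sympForm_comm, sympForm_add_left, neg_add, ← sympForm_comm, ← sympForm_comm])
    (fun a v w => by
      rw [sympForm_comm, sympForm_smul_left, ← mul_neg, ← sympForm_comm, smul_eq_mul])

theorem sympBilin_isRefl (Q : Type*) [Fintype Q] : (sympBilin Q).IsRefl := by
  intro v w h
  change sympForm w v = 0
  rw [sympForm_comm, neg_eq_zero]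
  exact h

theorem sympForm_pauliAt {Q : Type*} [Fintype Q] (v : PauliSpace Q) (j : Q)
    (p : ZMod 2 × ZMod 2) : sympForm v (pauliAt j p) = v.1 j * p.2 - v.2 j * p.1 := by
  classical
  simp [sympForm, pauliAt, Pi.single_apply, Finset.sum_sub_distrib]

theorem sympBilin_nondegenerate (Q : Type*) [Fintype Q] : (sympBilin Q).Nondegenerate := by
  refine (sympBilin_isRefl Q).nondegenerate_iff_separatingLeft.2 fun v hv => ?_
  ext j
  · have := hv (pauliAt j (0, 1))
    change sympForm _ _ = 0 at this
    simpa [sympForm_pauliAt] using this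
  · have := hv (pauliAt j (1, 0))
    change sympForm _ _ = 0 at this
    simpa [sympForm_pauliAt] using this

theorem finrank_add_finrank_sympPerp {Q : Type*} [Fintype Q]
    (W : Submodule (ZMod 2) (PauliSpace Q)) :
    Module.finrank (ZMod 2) W + Module.finrank (ZMod 2) (sympPerp W) = 2 * Fintype.card Q := by
  have h : sympPerp W = (sympBilin Q).orthogonal W := by
    ext v
    refine forall₂_congr fun c _ => ?_
    change sympForm v c = 0 ↔ sympForm c v = 0
    rw [sympForm_comm, neg_eq_zero]
  rw [h, LinearMap.BilinForm.finrank_orthogonal (sympBilin_nondegenerate Q),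
    Nat.add_sub_cancel' (Submodule.finrank_le W)]
  simp [two_mul]

/-! ### Functions on the faces -/

namespace GenonGraph

variable {D : Type*} [Fintype D] (Γ : GenonGraph D)

theorem exists_eq_comp_faceOf {α : Type*} {u : D → α}
    (h : ∀ d, u (Γ.rev (Γ.next d)) = u d) : ∃ c : Γ.Face → α, ∀ d, u d = c (Γ.faceOf d) := by
  have hstep : ∀ d, u (Γ.faceNext d) = u d := by
    intro d
    rw [← h (Γ.faceNext d)]
    simp [faceNext, Γ.rev_rev]
  refine ⟨Quotient.lift u fun d e hde => ?_, fun d => rfl⟩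
  obtain ⟨n, -, rfl⟩ := Equiv.Perm.SameCycle.exists_pow_eq' hde
  clear hde
  induction n with
  | zero => rfl
  | succ n ih => rw [ih, pow_succ', Equiv.Perm.mul_apply, hstep]

theorem vertexOf_next (d : D) : Γ.vertexOf (Γ.next d) = Γ.vertexOf d :=
  (Quotient.sound ⟨1, by simp⟩ : Γ.vertexOf d = Γ.vertexOf (Γ.next d)).symm

theorem faceOf_surjective : Function.Surjective Γ.faceOf := Quotient.mk_surjective

/-- A function on the darts that is invariant under `next` and `rev` is constant. -/
theorem eq_of_invariant {α : Type*} {j : D → α} (hnext : ∀ d, j (Γ.next d) = j d)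
    (hrev : ∀ d, j (Γ.rev d) = j d) (d d' : D) : j d = j d' := by
  obtain ⟨g, hg, rfl⟩ := Γ.connected d d'
  induction hg using Subgroup.closure_induction generalizing d with
  | mem x hx =>
    rcases hx with rfl | rfl
    · exact (hnext d).symm
    · exact (hrev d).symm
  | one => rfl
  | mul x y _ _ hx hy => rw [Equiv.Perm.mul_apply, ← hx, ← hy]
  | inv x _ hx => exact (hx (x⁻¹ d)).trans (congrArg j (x.apply_symm_apply d)) |>.symm

/-- The jump of a function on the faces across the edge of a dart. -/
def jump (c : Γ.Face → ZMod 2) (d : D) : ZMod 2 := c (Γ.faceOf d) + c (Γ.faceOf (Γ.rev d))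

theorem jump_rev (c : Γ.Face → ZMod 2) (d : D) : Γ.jump c (Γ.rev d) = Γ.jump c d := by
  rw [jump, jump, Γ.rev_rev, add_comm]

theorem jump_next (c : Γ.Face → ZMod 2) (d : D) :
    Γ.jump c (Γ.next d) = c (Γ.faceOf d) + c (Γ.faceOf (Γ.next d)) := by
  rw [jump, faceOf_eq_of_corner, add_comm]

/-- The coefficients `c` agree on faces two corners apart if and only if the jump of `c` is
the same across all edges. -/
theorem forall_next_next_iff_jump (c : Γ.Face → ZMod 2) :
    (∀ d, c (Γ.faceOf d) = c (Γ.faceOf (Γ.next (Γ.next d)))) ↔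
      ∃ ε, ∀ d, Γ.jump c d = ε := by
  constructor
  · intro h
    obtain ⟨d₀⟩ := Γ.nonempty
    refine ⟨Γ.jump c d₀, fun d => Γ.eq_of_invariant (fun e => ?_) (Γ.jump_rev c) d d₀⟩
    obtain ⟨e, rfl⟩ := Γ.next.surjective e
    rw [jump_next, jump_next, ← h e, add_comm]
  · rintro ⟨ε, h⟩ d
    have h1 := (h (Γ.next d)).trans (h (Γ.next (Γ.next d))).symm
    rw [jump_next, jump_next, add_comm] at h1
    exact add_left_cancel h1

theorem eq_const_of_jump_eq_zero {c : Γ.Face → ZMod 2} (h : ∀ d, Γ.jump c d = 0) :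
    ∃ a : ZMod 2, c = fun _ => a := by
  have h0 : ∀ x y : ZMod 2, x + y = 0 → y = x := by decide
  obtain ⟨d₀⟩ := Γ.nonempty
  refine ⟨c (Γ.faceOf d₀), funext fun f => ?_⟩
  obtain ⟨d, rfl⟩ := Γ.faceOf_surjective f
  refine Γ.eq_of_invariant (j := fun d => c (Γ.faceOf d)) (fun e => ?_) (fun e => ?_) d d₀
  · exact h0 _ _ (Γ.jump_next c e ▸ h (Γ.next e))
  · exact h0 _ _ (h e)

theorem bicolourable_iff_exists_jump_eq_one :
    Γ.Bicolourable ↔ ∃ χ : Γ.Face → ZMod 2, ∀ d, Γ.jump χ d = 1 := by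
  constructor
  · rintro ⟨col, h⟩
    refine ⟨fun f => if col f then 1 else 0, fun d => ?_⟩
    have := h d
    revert this
    change _ → (if col (Γ.faceOf d) then (1 : ZMod 2) else 0) +
      (if col (Γ.faceOf (Γ.rev d)) then 1 else 0) = 1
    generalize col (Γ.faceOf d) = x
    generalize col (Γ.faceOf (Γ.rev d)) = y
    revert x y
    decide
  · rintro ⟨χ, h⟩
    refine ⟨fun f => decide (χ f = 1), fun d => ?_⟩
    have := h d
    revert this
    change χ (Γ.faceOf d) + χ (Γ.faceOf (Γ.rev d)) = 1 →
      decide (χ (Γ.faceOf d) = 1) ≠ decide (χ (Γ.faceOf (Γ.rev d)) = 1)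
    generalize χ (Γ.faceOf d) = x
    generalize χ (Γ.faceOf (Γ.rev d)) = y
    revert x y
    decide

/-- The functions on the faces with the same jump across all edges. -/
def constJump : Submodule (ZMod 2) (Γ.Face → ZMod 2) where
  carrier := {c | ∃ ε, ∀ d, Γ.jump c d = ε}
  add_mem' := by
    rintro a b ⟨ε, ha⟩ ⟨δ, hb⟩
    refine ⟨ε + δ, fun d => ?_⟩
    rw [← ha d, ← hb d]
    simp only [jump, Pi.add_apply]
    ring
  zero_mem' := ⟨0, fun d => by simp [jump]⟩
  smul_mem' := by
    rintro a c ⟨ε, hc⟩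
    refine ⟨a * ε, fun d => ?_⟩
    rw [← hc d]
    simp only [jump, Pi.smul_apply, smul_eq_mul]
    ring

theorem one_ne_zero_face : (1 : Γ.Face → ZMod 2) ≠ 0 := by
  obtain ⟨d₀⟩ := Γ.nonempty
  intro h
  exact one_ne_zero (congrFun h (Γ.faceOf d₀))

theorem jump_one (d : D) : Γ.jump 1 d = 0 := by
  change (1 : ZMod 2) + 1 = 0
  decide

theorem const_eq_smul_one (a : ZMod 2) : (fun _ => a : Γ.Face → ZMod 2) = a • 1 := by
  ext f
  simp

theorem finrank_constJump_of_not_bicolourable (h : ¬ Γ.Bicolourable) :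
    Module.finrank (ZMod 2) Γ.constJump = 1 := by
  have hspan : Γ.constJump = Submodule.span (ZMod 2) {1} := by
    refine le_antisymm ?_ ?_
    · rintro c ⟨ε, hc⟩
      have hε : ε = 0 := by
        by_contra hne
        have h1 : ∀ x : ZMod 2, x ≠ 0 → x = 1 := by decide
        exact h (Γ.bicolourable_iff_exists_jump_eq_one.2 ⟨c, fun d => (hc d).trans (h1 ε hne)⟩)
      subst hε
      obtain ⟨a, rfl⟩ := Γ.eq_const_of_jump_eq_zero hc
      exact Submodule.mem_span_singleton.2 ⟨a, (Γ.const_eq_smul_one a).symm⟩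
    · rw [Submodule.span_singleton_le_iff_mem]
      exact ⟨0, Γ.jump_one⟩
  rw [hspan, finrank_span_singleton Γ.one_ne_zero_face]

theorem finrank_constJump_of_bicolourable (h : Γ.Bicolourable) :
    Module.finrank (ZMod 2) Γ.constJump = 2 := by
  obtain ⟨χ, hχ⟩ := Γ.bicolourable_iff_exists_jump_eq_one.1 h
  have hlin : ∀ (s t : ZMod 2) d, Γ.jump (s • 1 + t • χ) d = t := by
    intro s t d
    have h1 := Γ.jump_one d
    have h2 := hχ d
    simp only [jump, Pi.add_apply, Pi.smul_apply, smul_eq_mul] at h1 h2 ⊢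
    linear_combination s * h1 + t * h2
  have hspan : Γ.constJump = Submodule.span (ZMod 2) (Set.range ![1, χ]) := by
    rw [Matrix.range_cons, Matrix.range_cons, Matrix.range_empty, Set.union_empty,
      Set.singleton_union]
    ext c
    rw [Submodule.mem_span_pair]
    constructor
    · rintro ⟨ε, hc⟩
      obtain ⟨a, ha⟩ := Γ.eq_const_of_jump_eq_zero (c := c - ε • χ) fun d => by
        have h1 := hc d
        have h2 := hχ d
        simp only [jump, Pi.sub_apply, Pi.smul_apply, smul_eq_mul] at h1 h2 ⊢
        linear_combination h1 - ε * h2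
      exact ⟨a, ε, by rw [← Γ.const_eq_smul_one, ← ha, sub_add_cancel]⟩
    · rintro ⟨s, t, rfl⟩
      exact ⟨t, hlin s t⟩
  have hind : LinearIndependent (ZMod 2) ![1, χ] := by
    rw [LinearIndependent.pair_iff]
    intro s t hst
    obtain ⟨d₀⟩ := Γ.nonempty
    have ht : t = 0 := by
      rw [← hlin s t d₀, hst]
      simp [jump]
    subst ht
    rw [zero_smul, add_zero] at hst
    exact ⟨(smul_eq_zero.1 hst).resolve_right Γ.one_ne_zero_face, rfl⟩
  rw [hspan, finrank_span_eq_card hind, Fintype.card_fin]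

/-! ### String operators without corner parities -/

theorem mem_span_internalString_iff (u : Γ.stringSpace) :
    u ∈ Submodule.span (ZMod 2) (Set.range Γ.internalString) ↔
      ∀ d, Γ.cornerParity u.1 d = 0 := by
  classical
  constructor
  · intro hu
    induction hu using Submodule.span_induction with
    | mem x hx =>
      obtain ⟨f, rfl⟩ := hx
      exact Γ.internalVec_cornerParity f
    | zero => simp [cornerParity]
    | add x y _ _ hx hy =>
      intro d
      have h1 := hx d
      have h2 := hy d
      simp only [cornerParity, Submodule.coe_add, Pi.add_apply] at h1 h2 ⊢
      linear_combination h1 + h2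
    | smul a x _ hx =>
      intro d
      have h1 := hx d
      simp only [cornerParity, Submodule.coe_smul, Pi.smul_apply, smul_eq_mul] at h1 ⊢
      linear_combination a * h1
  · intro h
    have h0 : ∀ x y : ZMod 2, x + y = 0 → y = x := by decide
    obtain ⟨c, hc⟩ := Γ.exists_eq_comp_faceOf fun d => h0 _ _ (h d)
    rw [Submodule.mem_span_range_iff_exists_fun]
    refine ⟨c, Subtype.ext (funext fun d => ?_)⟩
    simp [internalString, internalVec, hc, Finset.sum_apply]

theorem linearIndependent_internalString : LinearIndependent (ZMod 2) Γ.internalString := by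
  classical
  rw [Fintype.linearIndependent_iff]
  intro c hc f
  obtain ⟨d, rfl⟩ := Γ.faceOf_surjective f
  have := congrFun (congrArg Subtype.val hc) d
  simpa [internalString, internalVec, Submodule.coe_sum, Finset.sum_apply] using this

end GenonGraph

/-! ### The map from string operators to logical operators -/

namespace GenonCode

variable {D : Type*} [Fintype D] {Γ : GenonGraph D} (C : GenonCode Γ)

theorem label_ne_next (d : D) : C.label d ≠ C.label (Γ.next d) := by
  rcases Γ.val_cases d with hd | hd
  · exact (C.label₃ d hd).1
  · exact (C.label₄ d hd).1

/-- The symplectic product of `v` with the label of the corner between `d` and `next d`. -/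
noncomputable def syndrome (v : PauliSpace Γ.Vertex) (d : D) : ZMod 2 :=
  sympForm v (pauliAt (Γ.vertexOf d) (C.label d).vec)

theorem syndrome_eq (v : PauliSpace Γ.Vertex) (d : D) : C.syndrome v d =
    v.1 (Γ.vertexOf d) * (C.label d).vec.2 - v.2 (Γ.vertexOf d) * (C.label d).vec.1 :=
  sympForm_pauliAt _ _ _

theorem sympForm_stabilizer (v : PauliSpace Γ.Vertex) (f : Γ.Face) [DecidableEq Γ.Face] :
    sympForm v (C.stabilizer f) = ∑ d : D, if Γ.faceOf d = f then C.syndrome v d else 0 := by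
  change sympBilin _ v (C.stabilizer f) = _
  rw [stabilizer, map_sum]
  refine Finset.sum_congr rfl fun d _ => ?_
  split_ifs
  · rfl
  · exact map_zero _

theorem cornerParity_eq (u : Γ.stringSpace) (d : D) :
    Γ.cornerParity u.1 d = C.syndrome (C.toPauli u) d := by
  have h1 := congrArg Prod.fst (C.toPauli_apply u d)
  have h2 := congrArg Prod.snd (C.toPauli_apply u d)
  simp only at h1 h2
  rw [syndrome_eq, h1, h2]
  have hne := C.label_ne_next d
  unfold localPauli
  revert hne
  generalize Γ.cornerParity u.1 d = x
  generalize Γ.cornerParity u.1 (Γ.next d) = y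
  generalize C.label d = a
  generalize C.label (Γ.next d) = b
  cases a <;> cases b <;> simp [PauliLabel.vec]

/-- A Pauli operator is recovered at a vertex from its products with two adjacent labels, in
the way in which `φ` computes it from the corner parities. -/
theorem syndrome_reconstruct (v : PauliSpace Γ.Vertex) (d : D) :
    C.syndrome v (Γ.next d) • (C.label d).vec + C.syndrome v d • (C.label (Γ.next d)).vec =
      (v.1 (Γ.vertexOf d), v.2 (Γ.vertexOf d)) := by
  have hne := C.label_ne_next d
  rw [syndrome_eq, syndrome_eq, Γ.vertexOf_next]
  revert hne
  generalize v.1 (Γ.vertexOf d) = x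
  generalize v.2 (Γ.vertexOf d) = y
  generalize C.label d = a
  generalize C.label (Γ.next d) = b
  cases a <;> cases b <;> simp [PauliLabel.vec] <;> revert x y <;> decide

theorem ext_syndrome {v w : PauliSpace Γ.Vertex} (h : ∀ d, C.syndrome v d = C.syndrome w d) :
    v = w := by
  have key : ∀ j, (v.1 j, v.2 j) = (w.1 j, w.2 j) := by
    intro j
    obtain ⟨d, rfl⟩ : ∃ d, Γ.vertexOf d = j := Quotient.mk_surjective j
    rw [← C.syndrome_reconstruct v d, ← C.syndrome_reconstruct w d, h, h]
  exact Prod.ext (funext fun j => congrArg Prod.fst (key j))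
    (funext fun j => congrArg Prod.snd (key j))

theorem toPauli_eq_zero_iff (u : Γ.stringSpace) :
    C.toPauli u = 0 ↔ ∀ d, Γ.cornerParity u.1 d = 0 := by
  constructor
  · intro h d
    rw [C.cornerParity_eq, h]
    simp [syndrome_eq]
  · intro h
    refine C.ext_syndrome fun d => ?_
    rw [← C.cornerParity_eq, h]
    simp [syndrome_eq]

theorem ker_phi :
    LinearMap.ker C.phi = Submodule.span (ZMod 2) (Set.range Γ.internalString) := by
  ext u
  rw [Γ.mem_span_internalString_iff, ← C.toPauli_eq_zero_iff, LinearMap.mem_ker]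
  exact Subtype.ext_iff

/-- A vector with the corner parities prescribed by a Pauli operator is an allowed string: the
labels at a 3-valent vertex have sum zero, and opposite labels at a 4-valent vertex agree. -/
theorem mem_stringSpace_of_cornerParity_eq_syndrome {u : D → ZMod 2} {v : PauliSpace Γ.Vertex}
    (h : ∀ d, Γ.cornerParity u d = C.syndrome v d) : u ∈ Γ.stringSpace := by
  rw [Γ.mem_stringSpace]
  have h2 : ∀ x : ZMod 2, x + x = 0 := by decide
  refine fun d => ⟨fun hd => ?_, fun hd => ?_⟩
  · obtain ⟨h1, h2, h3⟩ := C.label₃ d hd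
    simp only [h, syndrome_eq, Γ.vertexOf_next]
    revert h1 h2 h3
    generalize v.1 (Γ.vertexOf d) = x
    generalize v.2 (Γ.vertexOf d) = y
    generalize C.label d = a
    generalize C.label (Γ.next d) = b
    generalize C.label (Γ.next (Γ.next d)) = c
    cases a <;> cases b <;> cases c <;> simp [PauliLabel.vec] <;> revert x y <;> decide
  · have hv : Γ.val (Γ.next d) = 4 := by
      rw [← hd]
      exact Function.minimalPeriod_apply (Γ.next.injective.mem_periodicPts d)
    simp only [h, syndrome_eq, Γ.vertexOf_next, (C.label₄ d hd).2, (C.label₄ _ hv).2, h2, and_self]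

theorem phi_surjective : Function.Surjective C.phi := by
  classical
  rintro ⟨v, hv⟩
  have hsum : ∀ f, ∑ d : D, (if Γ.faceOf d = f then C.syndrome v d else 0) = 0 := fun f => by
    rw [← C.sympForm_stabilizer]
    exact hv _ (Submodule.subset_span ⟨f, rfl⟩)
  have hinv : Γ.rev * Γ.next = Γ.faceNext⁻¹ := by
    rw [eq_comm, inv_eq_iff_mul_eq_one]
    ext d
    simp [GenonGraph.faceNext, Γ.rev_rev]
  obtain ⟨u, hu⟩ := exists_sub_comp_perm_eq (Γ.rev * Γ.next) Γ.faceOf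
    (fun d d' h => by
      rw [hinv, Equiv.Perm.sameCycle_inv]
      exact Quotient.exact h) (C.syndrome v) hsum
  -- over `𝔽₂` the difference along the face boundary is the corner parity
  have hpar : ∀ d, Γ.cornerParity u d = C.syndrome v d := fun d => by
    rw [← hu d, sub_eq_add_neg, ZMod.neg_eq_self_mod_two, add_comm]
    rfl
  refine ⟨⟨u, C.mem_stringSpace_of_cornerParity_eq_syndrome hpar⟩, Subtype.ext ?_⟩
  refine C.ext_syndrome fun d => ?_
  rw [← hpar]
  exact (C.cornerParity_eq _ d).symm

theorem finrank_stringSpace :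
    Module.finrank (ZMod 2) Γ.stringSpace =
      Module.finrank (ZMod 2) C.code.logical + Fintype.card Γ.Face := by
  rw [← LinearMap.finrank_range_add_finrank_ker C.phi, C.ker_phi,
    finrank_span_eq_card Γ.linearIndependent_internalString,
    LinearMap.range_eq_top.2 C.phi_surjective, finrank_top]

/-! ### Relations between the face stabilizers -/

theorem linearCombination_stabilizer_eq_zero_iff (c : Γ.Face → ZMod 2) :
    ∑ f, c f • C.stabilizer f = 0 ↔
      ∀ d, c (Γ.faceOf d) = c (Γ.faceOf (Γ.next (Γ.next d))) := by
  classical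
  have hext : ∑ f, c f • C.stabilizer f = C.toPauli (∑ f, c f • Γ.externalString f) := by
    simp only [map_sum, map_smul, C.toPauli_externalString]
  have hpar : ∀ d, Γ.cornerParity (∑ f, c f • Γ.externalString f).1 (Γ.next d) =
      c (Γ.faceOf d) + c (Γ.faceOf (Γ.next (Γ.next d))) := by
    intro d
    have h := Γ.faceOf_eq_of_corner d
    simp [GenonGraph.cornerParity, GenonGraph.externalString, GenonGraph.externalVec,
      GenonGraph.internalVec, Γ.rev_rev, h]
  have h0 : ∀ x y : ZMod 2, x + y = 0 ↔ x = y := by decide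
  rw [hext, C.toPauli_eq_zero_iff, Γ.next.surjective.forall]
  simp only [hpar, h0]

theorem finrank_codespace_add :
    Module.finrank (ZMod 2) C.codespace + Module.finrank (ZMod 2) Γ.constJump =
      Fintype.card Γ.Face := by
  have hker : LinearMap.ker (Fintype.linearCombination (ZMod 2) C.stabilizer) = Γ.constJump := by
    ext c
    rw [LinearMap.mem_ker, Fintype.linearCombination_apply,
      C.linearCombination_stabilizer_eq_zero_iff, Γ.forall_next_next_iff_jump]
    rfl
  rw [codespace, ← Fintype.range_linearCombination, ← hker,
    LinearMap.finrank_range_add_finrank_ker, Module.finrank_fintype_fun_eq_card]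

theorem finrank_logical_quotient_add :
    Module.finrank (ZMod 2) (C.code.logical ⧸ C.code.space.comap C.code.logical.subtype) +
      Module.finrank (ZMod 2) C.codespace = Module.finrank (ZMod 2) C.code.logical := by
  have h : Module.finrank (ZMod 2) (C.code.space.comap C.code.logical.subtype) =
      Module.finrank (ZMod 2) C.codespace :=
    (Submodule.comapSubtypeEquivOfLe C.code.isotropic).finrank_eq
  rw [← h, Submodule.finrank_quotient_add_finrank]

end GenonCode

theorem mainTheorem8 {D : Type*} [Fintype D] (Γ : GenonGraph D) (C : GenonCode Γ)
    (n k : ℕ) (d : ℕ∞) (hC : C.code.HasParameters n k d) (F : ℕ) (hF : Nat.card Γ.Face = F) :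
    (Γ.Bicolourable →
      (Module.finrank (ZMod 2) Γ.stringSpace : ℤ) = 2 * (k : ℤ) + 2 * (F : ℤ) - 2 ∧
      (Module.finrank (ZMod 2) Γ.stringSpace : ℤ) = 2 * (n : ℤ) + 2) ∧
    (¬ Γ.Bicolourable →
      (Module.finrank (ZMod 2) Γ.stringSpace : ℤ) = 2 * (k : ℤ) + 2 * (F : ℤ) - 1 ∧
      (Module.finrank (ZMod 2) Γ.stringSpace : ℤ) = 2 * (n : ℤ) + 1) ∧
    Function.Surjective C.phi ∧
    LinearMap.ker C.phi = Submodule.span (ZMod 2) (Set.range Γ.internalString) := by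
  have hn := hC.qubits
  have hk := hC.logical_qubits
  rw [Nat.card_eq_fintype_card] at hn hF
  -- `dim S`, `dim C^⊥`, `dim C^⊥ / C` and `dim C` in terms of each other, `n`, `k` and `F`
  have hS := C.finrank_stringSpace
  have hperp : Module.finrank (ZMod 2) C.codespace + Module.finrank (ZMod 2) C.code.logical =
      2 * Fintype.card Γ.Vertex := finrank_add_finrank_sympPerp C.codespace
  have hrel := C.finrank_codespace_add
  have hquot := C.finrank_logical_quotient_add
  refine ⟨fun h => ?_, fun h => ?_, C.phi_surjective, C.ker_phi⟩
  · have := Γ.finrank_constJump_of_bicolourable h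
    omega
  · have := Γ.finrank_constJump_of_not_bicolourable h
    omega
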